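/- Fix a field $\mathbb{k}$. A persistence module is a functor $M\colon(\mathbb{R},\leq)\to\mathbf{Vect}_{\mathbb{k}}$; these form an abelian category with enough projectives. For $-\infty<a<b\leq\infty$ let $\mathbb{k}[a,b)$ denote the interval module, equal to $\mathbb{k}$ on $[a,b)$ with identity structure maps there, and $0$ elsewhere. A persistence module is finitely presented if it is isomorphic to the cokernel of a morphism $\bigoplus_{j=1}^n\mathbb{k}[d_j,\infty)\to\bigoplus_{i=1}^m\mathbb{k}[c_i,\infty)$ with $m,n$ finite. A finitely presented persistence module $M$ has a barcode decomposition $M\cong\bigoplus_{i=1}^{n}\mathbb{k}[a_i,b_i)$, unique up to order, and its persistent magnitude is $$|M|=\sum_{i=1}^n\left(e^{-a_i}-e^{-b_i}\right),\qquad e^{-\infty}:=0.$$ The tensor product of persistence modules is $$(M\otimes N)(s)=\operatorname*{colim}_{s_1+s_2\leq s}M(s_1)\otimes_{\mathbb{k}} N(s_2),$$ and $\operatorname{Tor}_i(M,-)$ denotes the $i$-th left derived functor of $M\otimes-$. Let $M$ and $N$ be finitely presented persistence modules. Then $M\otimes N$ and all $\operatorname{Tor}_i(M,N)$, $i\ge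 0$, are finitely presented, and $$|M|\cdot|N|=|M\otimes N|-|\operatorname{Tor}_1(M,N)|.$$ Moreover $\operatorname{Tor}_i(M,N)=0$ for $i\geq 2$, so that persistent magnitude is multiplicative for the derived tensor product: $$|M|\cdot|N|=\sum_{i=0}^\infty(-1)^i\,|\operatorname{Tor}_i(M,N)|.$$ -/

import Mathlib

open CategoryTheory CategoryTheory.Limits CategoryTheory.MonoidalCategory

universe u

noncomputable section

namespace Persistence

/-- Persistence modules over `k`: functors from the ordered set `(ℝ, ≤)` to `k`-vector spaces. -/
abbrev PersMod (k : Type u) [Field k] := ℝ ⥤ ModuleCat.{u} k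

section Intervals

variable (k : Type u) [Field k]

/-- The value of the interval module `kJ` at `x`, as a subspace of `k`: all of `k` if `x ∈ J`,
and `0` otherwise. -/
def intervalSpace (J : Set ℝ) (x : ℝ) : Submodule k k where
  carrier := {c | x ∉ J → c = 0}
  add_mem' := by
    intro c d hc hd hx
    simp [hc hx, hd hx]
  zero_mem' := fun _ => rfl
  smul_mem' := by
    intro r c hc hx
    simp [hc hx]

open Classical in
/-- The structure map of `kJ` from `x` to `y`: the identity of `k` if `x, y ∈ J`, otherwise `0`
(if `x ∉ J` then the source is already `0`). -/
def intervalMap (J : Set ℝ) (x y : ℝ) : intervalSpace k J x →ₗ[k] intervalSpace k J y where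
  toFun c := ⟨if y ∈ J then c.1 else 0, fun hy => if_neg hy⟩
  map_add' := by
    intro c d
    ext
    by_cases hy : y ∈ J <;> simp [hy]
  map_smul' := by
    intro r c
    ext
    by_cases hy : y ∈ J <;> simp [hy]

/-- The interval module `kJ` of an interval `J ⊆ ℝ`. -/
def intervalModule (J : Set ℝ) (hJ : J.OrdConnected) : PersMod k where
  obj x := ModuleCat.of k (intervalSpace k J x)
  map {x y} _ := ModuleCat.ofHom (intervalMap k J x y)
  map_id x := by
    ext c
    by_cases hx : x ∈ J
    · simp [intervalMap, hx]
    · have := c.2 hx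
      simp [intervalMap, hx, this]
  map_comp {x y z} f g := by
    ext c
    by_cases hz : z ∈ J
    · by_cases hy : y ∈ J
      · simp [intervalMap, hy, hz]
      · have hx : x ∉ J := fun hx => hy (hJ.out hx hz ⟨leOfHom f, leOfHom g⟩)
        have := c.2 hx
        simp [intervalMap, hy, hz, this]
    · simp [intervalMap, hz]

/-- The free persistence module `k[a,∞)` on one generator in degree `a`. -/
abbrev freeModule (a : ℝ) : PersMod k := intervalModule k (Set.Ici a) Set.ordConnected_Ici

/-- The half-open interval `[a,b)`, where `b = ∞` is allowed. -/
def halfOpen (a : ℝ) (b : WithTop ℝ) : Set ℝ := {x | a ≤ x ∧ (x : WithTop ℝ) < b}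

theorem ordConnected_halfOpen (a : ℝ) (b : WithTop ℝ) : (halfOpen a b).OrdConnected :=
  ⟨fun _ hx _ hy _ hz =>
    ⟨hx.1.trans hz.1, lt_of_le_of_lt (WithTop.coe_le_coe.mpr hz.2) hy.2⟩⟩

end Intervals

/-- A bar `[a,b)` with `-∞ < a < b ≤ ∞`. -/
structure Bar where
  birth : ℝ
  death : WithTop ℝ
  lt : (birth : WithTop ℝ) < death

/-- The interval module `k[a,b)` of a bar. -/
def Bar.module (k : Type u) [Field k] (β : Bar) : PersMod k :=
  intervalModule k (halfOpen β.birth β.death) (ordConnected_halfOpen β.birth β.death)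

/-- `e^{-b}`, with the convention `e^{-∞} = 0`. -/
def expNeg : WithTop ℝ → ℝ
  | none => 0
  | some b => Real.exp (-b)

/-- The weight `e^{-a} - e^{-b}` of a bar `[a,b)`. -/
def Bar.weight (β : Bar) : ℝ := Real.exp (-β.birth) - expNeg β.death

section Magnitude

variable {k : Type u} [Field k]

instance hasFiniteBiproducts_persMod : HasFiniteBiproducts (PersMod k) :=
  Abelian.hasFiniteBiproducts

/-- `M` is finitely presented: it has finitely many generators and finitely many relations, i.e.
it is the cokernel of a map between finite direct sums of modules `k[a,∞)`. -/
def IsFinitelyPresented (M : PersMod k) : Prop :=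
  ∃ (m n : ℕ) (a : Fin m → ℝ) (b : Fin n → ℝ)
    (f : (⨁ fun j => freeModule k (b j)) ⟶ (⨁ fun i => freeModule k (a i))),
    Nonempty (M ≅ cokernel f)

/-- `B` is a (finite) barcode decomposition of `M`. -/
def IsBarcode (M : PersMod k) (B : List Bar) : Prop :=
  Nonempty (M ≅ ⨁ fun i : Fin B.length => (B.get i).module k)

open Classical in
/-- The magnitude `|M| = ∑ (e^{-a_i} - e^{-b_i})`, the sum being over a barcode decomposition
`M ≅ ⨁ k[a_i,b_i)`. (The value is only meaningful if such a decomposition exists.) -/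
def magnitude (M : PersMod k) : ℝ :=
  if h : ∃ B : List Bar, IsBarcode M B then (h.choose.map Bar.weight).sum else 0

end Magnitude

section Tensor

variable {k : Type u} [Field k]

/-- Addition as a functor `(s₁, s₂) ↦ s₁ + s₂`. An object of `CostructuredArrow addFunctor s` is a
pair `(s₁, s₂)` with `s₁ + s₂ ≤ s`. -/
def addFunctor : ℝ × ℝ ⥤ ℝ where
  obj p := p.1 + p.2
  map f := homOfLE (add_le_add (leOfHom f.1) (leOfHom f.2))

/-- The functor `(s₁, s₂) ↦ M(s₁) ⊗ N(s₂)`. -/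
def external (M N : PersMod k) : ℝ × ℝ ⥤ ModuleCat.{u} k where
  obj p := M.obj p.1 ⊗ N.obj p.2
  map f := M.map f.1 ⊗ₘ N.map f.2

/-- The transformation `M(s₁) ⊗ N(s₂) ⟶ M(s₁) ⊗ N'(s₂)` induced by `N ⟶ N'`. -/
def externalMap (M : PersMod k) {N N' : PersMod k} (g : N ⟶ N') :
    external M N ⟶ external M N' where
  app p := M.obj p.1 ◁ g.app p.2
  naturality p q f := by
    change (M.map f.1 ⊗ₘ N.map f.2) ≫ M.obj q.1 ◁ g.app q.2 =
      M.obj p.1 ◁ g.app p.2 ≫ (M.map f.1 ⊗ₘ N'.map f.2)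
    rw [MonoidalCategory.tensorHom_def, MonoidalCategory.tensorHom_def, Category.assoc,
      ← MonoidalCategory.whiskerLeft_comp, NatTrans.naturality,
      MonoidalCategory.whiskerLeft_comp, whisker_exchange_assoc]

/-- The tensor product of persistence modules: `(M ⊗ N)(s)` is the colimit of `M(s₁) ⊗ N(s₂)`
over the pairs with `s₁ + s₂ ≤ s`. -/
def tensor (M N : PersMod k) : PersMod k :=
  addFunctor.pointwiseLeftKanExtension (external M N)

theorem tensor_obj (M N : PersMod k) (s : ℝ) :
    (tensor M N).obj s = colimit (CostructuredArrow.proj addFunctor s ⋙ external M N) := rfl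

/-- The map `M ⊗ N ⟶ M ⊗ N'` induced by `N ⟶ N'`, at `s`. -/
def tensorMapApp (M : PersMod k) {N N' : PersMod k} (g : N ⟶ N') (s : ℝ) :
    (tensor M N).obj s ⟶ (tensor M N').obj s :=
  colimMap (Functor.whiskerLeft (CostructuredArrow.proj addFunctor s) (externalMap M g))

/-- The structure map `M(s₁) ⊗ N(s₂) ⟶ (M ⊗ N)(s)` for a pair with `s₁ + s₂ ≤ s`. -/
def tensorι (M N : PersMod k) {s : ℝ} (j : CostructuredArrow addFunctor s) :
    M.obj j.left.1 ⊗ N.obj j.left.2 ⟶ (tensor M N).obj s :=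
  colimit.ι (CostructuredArrow.proj addFunctor s ⋙ external M N) j

theorem tensor_hom_ext {M N : PersMod k} {s : ℝ} {X : ModuleCat.{u} k}
    {f g : (tensor M N).obj s ⟶ X} (h : ∀ j, tensorι M N j ≫ f = tensorι M N j ≫ g) : f = g :=
  colimit.hom_ext h

theorem tensorι_map (M N : PersMod k) {s t : ℝ} (j : CostructuredArrow addFunctor s)
    (f : s ⟶ t) : tensorι M N j ≫ (tensor M N).map f =
      tensorι M N ((CostructuredArrow.map f).obj j) :=
  colimit.ι_desc _ _

theorem tensorι_mapApp (M : PersMod k) {N N' : PersMod k} (g : N ⟶ N') {s : ℝ}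
    (j : CostructuredArrow addFunctor s) : tensorι M N j ≫ tensorMapApp M g s =
      M.obj j.left.1 ◁ g.app j.left.2 ≫ tensorι M N' j :=
  ι_colimMap _ _

/-- The functor `M ⊗ -`. -/
def tensoring (M : PersMod k) : PersMod k ⥤ PersMod k where
  obj N := tensor M N
  map {N N'} g :=
    { app := tensorMapApp M g
      naturality := fun s t f => tensor_hom_ext fun j => by
        rw [← Category.assoc, tensorι_map, tensorι_mapApp, ← Category.assoc, tensorι_mapApp,
          Category.assoc, tensorι_map]
        rfl }
  map_id N := by
    ext1; ext1 s
    refine tensor_hom_ext fun j => ?_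
    rw [tensorι_mapApp, NatTrans.id_app, NatTrans.id_app, MonoidalCategory.whiskerLeft_id,
      Category.id_comp, Category.comp_id]
  map_comp f g := by
    ext1; ext1 s
    refine tensor_hom_ext fun j => ?_
    rw [tensorι_mapApp, NatTrans.comp_app, NatTrans.comp_app, MonoidalCategory.whiskerLeft_comp,
      ← Category.assoc, tensorι_mapApp, Category.assoc, Category.assoc, tensorι_mapApp]

instance additive_tensoring (M : PersMod k) : (tensoring M).Additive where
  map_add {N N' f g} := by
    ext1; ext1 s
    refine tensor_hom_ext fun j => ?_
    change tensorι M N j ≫ tensorMapApp M (f + g) s =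
      tensorι M N j ≫ (tensorMapApp M f s + tensorMapApp M g s)
    rw [Preadditive.comp_add, tensorι_mapApp, tensorι_mapApp, tensorι_mapApp,
      NatTrans.app_add, MonoidalPreadditive.whiskerLeft_add, Preadditive.add_comp]

end Tensor

section Tor

variable {k : Type u} [Field k]

theorem projective_coproduct {C : Type*} [Category* C] {β : Type*} (g : β → C) [HasCoproduct g]
    (h : ∀ b, Projective (g b)) : Projective (∐ g) where
  factors f e _ := by
    refine ⟨Sigma.desc fun b => Projective.factorThru (Sigma.ι g b ≫ f) e, ?_⟩
    refine Sigma.hom_ext _ _ fun b => ?_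
    rw [← Category.assoc, Sigma.ι_desc, Projective.factorThru_comp]

/-- The category of persistence modules has enough projectives, so that derived functors exist. -/
instance enoughProjectives_persMod : EnoughProjectives (PersMod k) where
  presentation M := by
    have hp : ∀ s : ℝ, Projective ((evaluationLeftAdjoint (ModuleCat.{u} k) s).obj
        (Projective.over (M.obj s))) := fun s =>
      (evaluationAdjunctionRight (ModuleCat.{u} k) s).map_projective _ inferInstance
    let p : ∀ s : ℝ, (evaluationLeftAdjoint (ModuleCat.{u} k) s).obj
        (Projective.over (M.obj s)) ⟶ M := fun s =>
      ((evaluationAdjunctionRight (ModuleCat.{u} k) s).homEquiv _ _).symm (Projective.π (M.obj s))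
    have hepi : Epi (Sigma.desc p) := by
      rw [NatTrans.epi_iff_epi_app]
      intro s
      have h : ((evaluationAdjunctionRight (ModuleCat.{u} k) s).unit.app _ ≫
          (Sigma.ι (fun s : ℝ => (evaluationLeftAdjoint (ModuleCat.{u} k) s).obj
            (Projective.over (M.obj s))) s).app s) ≫ (Sigma.desc p).app s =
          Projective.π (M.obj s) := by
        rw [Category.assoc, ← NatTrans.comp_app, Sigma.ι_desc]
        exact ((evaluationAdjunctionRight (ModuleCat.{u} k) s).homEquiv _ _).apply_symm_apply _
      exact epi_of_epi_fac h
    have hproj : Projective (∐ fun s : ℝ => (evaluationLeftAdjoint (ModuleCat.{u} k) s).obj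
        (Projective.over (M.obj s))) :=
      projective_coproduct _ hp
    exact ⟨{ p := ∐ fun s : ℝ => (evaluationLeftAdjoint (ModuleCat.{u} k) s).obj
               (Projective.over (M.obj s))
             projective := hproj
             f := Sigma.desc p
             epi := hepi }⟩

/-- `Tor_i(M, N)`: the `i`-th left derived functor of `M ⊗ -`, evaluated at `N`. -/
def tor (i : ℕ) (M N : PersMod k) : PersMod k := ((tensoring M).leftDerived i).obj N

end Tor

end Persistence

end

/-! The argument replaces finite presentation by tameness: finite-dimensional values and finitely
many critical values, below which the module vanishes. The two notions agree
(`tame_of_isFinitelyPresented`, `isFinitelyPresented_of_tame`), and tameness passes to kernels and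
cokernels by a pointwise diagram chase, so finite presentation of each `Tor` follows once it is
exhibited as such a kernel or cokernel.

Finite free modules have injective structure maps, hence so do their submodules, and a tame module
with this property has only infinite bars, i.e. is free. Covering `N` by a finite free module `P₀`
therefore gives a short exact sequence `0 → P₁ → P₀ → N → 0` with both terms finite free
(`Tame.exists_free_resolution`). Thus `Tor₀` and `Tor₁` are the cokernel and kernel of `M ⊗ P₁ → M ⊗
P₀`, and the higher `Tor` vanish. The barcodes needed here come from splitting off one bar at a time
(`TameOn.exists_bar_summand`).

Magnitude is the integral of `dim M(x)` against `e^{-x}` (`Tame.magnitude_eq`). This makes it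
independent of the barcode and, by rank-nullity, additive on exact sequences. Tensoring with
`k[a,∞)` shifts `M` by `a` (`tensorFreeIso`), which multiplies the magnitude by `e^{-a}`; hence `|M
⊗ P| = |M| |P|` for finite free `P`. Altogether `|Tor₀| - |Tor₁| = |M ⊗ P₀| - |M ⊗ P₁| = |M| (|P₀| -
|P₁|) = |M| |N|`. -/

noncomputable section

namespace Persistence

/-! ### Derived functors computed from a projective resolution of length one -/

section DerivedTwoTerm

open ZeroObject

universe v₁ u₁ v₂ u₂

variable {C : Type u₁} [Category.{v₁} C] [Abelian C] (S : ShortComplex C)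

/-- The objects of the two-term complex `S.X₁ ⟶ S.X₂`. -/
def twoTermX : ℕ → C
  | 0 => S.X₂
  | 1 => S.X₁
  | _ + 2 => 0

/-- The differentials of the two-term complex `S.X₁ ⟶ S.X₂`. -/
def twoTermD : ∀ n, twoTermX S (n + 1) ⟶ twoTermX S n
  | 0 => S.f
  | _ + 1 => 0

/-- The complex with `S.f : S.X₁ ⟶ S.X₂` in degrees `1` and `0`. -/
def twoTermComplex : ChainComplex C ℕ :=
  ChainComplex.of (twoTermX S) (twoTermD S) fun n => by
    cases n <;> exact zero_comp

theorem isZero_twoTermComplex_X (n : ℕ) : IsZero ((twoTermComplex S).X (n + 2)) :=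
  isZero_zero C

theorem twoTermComplex_d : (twoTermComplex S).d 1 0 = S.f :=
  ChainComplex.of_d (twoTermX S) (twoTermD S) 0

theorem projective_twoTermComplex_X (h₁ : Projective S.X₁) (h₂ : Projective S.X₂) :
    ∀ n, Projective ((twoTermComplex S).X n)
  | 0 => h₂
  | 1 => h₁
  | n + 2 => (isZero_twoTermComplex_X S n).projective

variable {S}

theorem twoTermComplex_exactAt_succ (hS : S.ShortExact) (n : ℕ) :
    (twoTermComplex S).ExactAt (n + 1) := by
  rw [HomologicalComplex.exactAt_iff' _ (n + 1 + 1) (n + 1) n (by simp) (by simp)]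
  match n with
  | 0 =>
    have := hS.mono_f
    refine (ShortComplex.exact_iff_mono _ ((isZero_twoTermComplex_X S 0).eq_of_src _ _)).2 ?_
    change Mono ((twoTermComplex S).d 1 0)
    rw [twoTermComplex_d]
    exact this
  | n + 1 => exact ShortComplex.exact_of_isZero_X₂ _ (isZero_twoTermComplex_X S n)

/-- A short exact sequence `0 ⟶ X₁ ⟶ X₂ ⟶ X₃ ⟶ 0` with `X₁` and `X₂` projective is a projective
resolution of `X₃`. -/
def twoTermResolution (hS : S.ShortExact) (h₁ : Projective S.X₁) (h₂ : Projective S.X₂) :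
    ProjectiveResolution S.X₃ where
  complex := twoTermComplex S
  projective := projective_twoTermComplex_X S h₁ h₂
  π := (ChainComplex.toSingle₀Equiv _ _).symm ⟨S.g, by
    rw [twoTermComplex_d]
    exact S.zero⟩
  quasiIso := ⟨fun n => by
    cases n with
    | zero =>
      rw [ChainComplex.quasiIsoAt₀_iff, ShortComplex.quasiIso_iff_of_zeros']
      · have := hS.epi_g
        refine (ShortComplex.exact_and_epi_g_iff_of_iso ?_).2 ⟨hS.exact, this⟩
        refine ShortComplex.isoMk (Iso.refl _) (Iso.refl _) (Iso.refl _) ?_ ?_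
        · refine (Category.id_comp _).trans ?_
          refine Eq.trans ?_ (Category.comp_id _).symm
          exact (twoTermComplex_d S).symm
        · refine (Category.id_comp _).trans ?_
          refine Eq.trans ?_ (Category.comp_id _).symm
          exact (ChainComplex.toSingle₀Equiv_symm_apply_f_zero (C := twoTermComplex S) (X := S.X₃)
            S.g _).symm
      all_goals rfl
    | succ n =>
      rw [quasiIsoAt_iff_exactAt']
      · exact twoTermComplex_exactAt_succ hS n
      · apply ChainComplex.exactAt_succ_single_obj⟩

variable [EnoughProjectives C] {D : Type u₂} [Category.{v₂} D] [Abelian D] (F : C ⥤ D) [F.Additive]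

theorem isZero_leftDerived_of_shortExact (hS : S.ShortExact) (h₁ : Projective S.X₁)
    (h₂ : Projective S.X₂) (n : ℕ) : IsZero ((F.leftDerived (n + 2)).obj S.X₃) := by
  refine IsZero.of_iso ?_ ((twoTermResolution hS h₁ h₂).isoLeftDerivedObj F (n + 2))
  refine HomologicalComplex.ExactAt.isZero_homology ?_
  exact ShortComplex.exact_of_isZero_X₂ _ (F.map_isZero (isZero_twoTermComplex_X S n))

/-- The complex is zero in degree two, so degree one has no boundaries: homology there equals
cycles, which form the kernel of the only nonzero differential. -/
theorem leftDerived_one_iso_kernel (hS : S.ShortExact) (h₁ : Projective S.X₁)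
    (h₂ : Projective S.X₂) : Nonempty ((F.leftDerived 1).obj S.X₃ ≅ kernel (F.map S.f)) := by
  let K := (F.mapHomologicalComplex _).obj (twoTermResolution hS h₁ h₂).complex
  have hd : K.d 1 0 = F.map S.f := congrArg F.map (twoTermComplex_d S)
  have h0 : K.d 2 1 = 0 :=
    (F.map_isZero (isZero_twoTermComplex_X S 0)).eq_of_src _ _
  refine ⟨(twoTermResolution hS h₁ h₂).isoLeftDerivedObj F 1 ≪≫
    (K.isoHomologyπ 2 1 (by simp) h0).symm ≪≫
    (K.cyclesIsKernel 1 0 (by simp)).conePointUniqueUpToIso (kernelIsKernel (K.d 1 0)) ≪≫ ?_⟩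
  exact kernelIsoOfEq hd

end DerivedTwoTerm

/-! ### Tame modules and their closure properties -/

section Tame

variable {k : Type u} [Field k]

theorem map_map_apply (M : PersMod k) {x y z : ℝ} (f : x ⟶ y) (g : y ⟶ z) (h : x ⟶ z)
    (v : M.obj x) : M.map g (M.map f v) = M.map h v := by
  rw [← ConcreteCategory.comp_apply, ← M.map_comp]
  rfl

theorem map_self_apply (M : PersMod k) {x : ℝ} (f : x ⟶ x) (v : M.obj x) : M.map f v = v := by
  rw [show f = 𝟙 x from rfl, M.map_id]
  rfl

theorem app_map_apply {M N : PersMod k} (φ : M ⟶ N) {x y : ℝ} (f : x ⟶ y) (v : M.obj x) :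
    φ.app y (M.map f v) = N.map f (φ.app x v) :=
  NatTrans.naturality_apply φ f v

/-- `M` is tame with critical values in the finite set `T`: it is pointwise finite-dimensional,
vanishes below `T`, and its structure map from `x` to `y` is bijective whenever no element of `T`
lies in `(x, y]`. -/
structure TameOn (T : Finset ℝ) (M : PersMod k) : Prop where
  finite : ∀ x, FiniteDimensional k (M.obj x)
  subsingleton : ∀ x, (∀ t ∈ T, x < t) → Subsingleton (M.obj x)
  bijective : ∀ (x y : ℝ) (f : x ⟶ y), (∀ t ∈ T, t ≤ x ∨ y < t) → Function.Bijective (M.map f)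

/-- A persistence module is tame if it has finitely many critical values. -/
def Tame (M : PersMod k) : Prop := ∃ T, TameOn T M

theorem TameOn.mono {T T' : Finset ℝ} {M : PersMod k} (h : TameOn T M) (hT : T ⊆ T') :
    TameOn T' M where
  finite := h.finite
  subsingleton x hx := h.subsingleton x fun t ht => hx t (hT ht)
  bijective x y f hf := h.bijective x y f fun t ht => hf t (hT ht)

theorem Tame.exists_common {M N : PersMod k} (hM : Tame M) (hN : Tame N) :
    ∃ T, TameOn T M ∧ TameOn T N := by
  classical
  obtain ⟨T, hT⟩ := hM
  obtain ⟨T', hT'⟩ := hN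
  exact ⟨T ∪ T', hT.mono Finset.subset_union_left, hT'.mono Finset.subset_union_right⟩

theorem app_injective_of_mono {M N : PersMod k} (φ : M ⟶ N) [Mono φ] (x : ℝ) :
    Function.Injective (φ.app x) :=
  (ModuleCat.mono_iff_injective _).1 inferInstance

theorem app_surjective_of_epi {M N : PersMod k} (φ : M ⟶ N) [Epi φ] (x : ℝ) :
    Function.Surjective (φ.app x) :=
  (ModuleCat.epi_iff_surjective _).1 inferInstance

theorem app_exact {S : ShortComplex (PersMod k)} (hS : S.Exact) (x : ℝ) :
    Function.Exact (S.f.app x) (S.g.app x) := by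
  have h : (S.map ((evaluation ℝ (ModuleCat.{u} k)).obj x)).Exact :=
    hS.map_of_preservesLeftHomologyOf _
  exact fun v => ⟨(ShortComplex.moduleCat_exact_iff _).1 h v, by
    rintro ⟨w, rfl⟩
    exact ShortComplex.moduleCat_zero_apply (S.map ((evaluation ℝ (ModuleCat.{u} k)).obj x)) w⟩

theorem TameOn.of_iso {T : Finset ℝ} {M N : PersMod k} (hM : TameOn T M) (e : M ≅ N) :
    TameOn T N := by
  have he : ∀ x, Function.Bijective (e.hom.app x) := fun x =>
    ⟨app_injective_of_mono e.hom x, app_surjective_of_epi e.hom x⟩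
  refine ⟨fun x => ?_, fun x hx => ?_, fun x y f hf => ?_⟩
  · have := hM.finite x
    exact Module.Finite.of_surjective (e.hom.app x).hom (he x).2
  · have := hM.subsingleton x hx
    exact (he x).2.subsingleton
  · have h : N.map f ∘ e.hom.app x = e.hom.app y ∘ M.map f := by
      funext v
      exact (app_map_apply e.hom f v).symm
    exact ((he x).of_comp_iff _).1 (h ▸ (he y).comp (hM.bijective x y f hf))

theorem Tame.of_iso {M N : PersMod k} (hM : Tame M) (e : M ≅ N) : Tame N :=
  hM.imp fun _ h => h.of_iso e

/-- The set `T` need not grow: on a stretch without critical values the structure maps of `M` and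
`N` are bijective, so a four-lemma chase gives the same for the cokernel. -/
theorem TameOn.cokernel {T : Finset ℝ} {M N : PersMod k} (hM : TameOn T M) (hN : TameOn T N)
    (f : M ⟶ N) : TameOn T (cokernel f) := by
  have hs : ∀ x, Function.Surjective ((cokernel.π f).app x) := app_surjective_of_epi _
  have he : ∀ x, Function.Exact (f.app x) ((cokernel.π f).app x) :=
    app_exact (ShortComplex.exact_cokernel f)
  refine ⟨fun x => ?_, fun x hx => ?_, fun x y g hg => ⟨?_, fun c => ?_⟩⟩
  · have := hN.finite x
    exact Module.Finite.of_surjective ((cokernel.π f).app x).hom (hs x)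
  · have := hN.subsingleton x hx
    exact (hs x).subsingleton
  · refine (injective_iff_map_eq_zero _).2 fun c hc => ?_
    obtain ⟨b, rfl⟩ := hs x c
    rw [← app_map_apply] at hc
    obtain ⟨a', ha'⟩ := (he y _).1 hc
    obtain ⟨a, rfl⟩ := (hM.bijective x y g hg).2 a'
    rw [app_map_apply] at ha'
    exact (he x _).2 ⟨a, (hN.bijective x y g hg).1 ha'⟩
  · obtain ⟨b', rfl⟩ := hs y c
    obtain ⟨b, rfl⟩ := (hN.bijective x y g hg).2 b'
    exact ⟨_, (app_map_apply _ g b).symm⟩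

theorem TameOn.kernel {T : Finset ℝ} {M N : PersMod k} (hM : TameOn T M) (hN : TameOn T N)
    (f : M ⟶ N) : TameOn T (kernel f) := by
  have hi : ∀ x, Function.Injective ((kernel.ι f).app x) := app_injective_of_mono _
  have he : ∀ x, Function.Exact ((kernel.ι f).app x) (f.app x) :=
    app_exact (ShortComplex.exact_kernel f)
  refine ⟨fun x => ?_, fun x hx => ?_, fun x y g hg => ⟨?_, fun c => ?_⟩⟩
  · have := hM.finite x
    exact Module.Finite.of_injective ((kernel.ι f).app x).hom (hi x)
  · have := hM.subsingleton x hx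
    exact (hi x).subsingleton
  · intro c d hcd
    refine hi x ((hM.bijective x y g hg).1 ?_)
    rw [← app_map_apply, ← app_map_apply, hcd]
  · obtain ⟨a, ha⟩ := (hM.bijective x y g hg).2 ((kernel.ι f).app y c)
    have h0 : f.app x a = 0 := by
      refine (hN.bijective x y g hg).1 ?_
      rw [← app_map_apply, ha, map_zero]
      exact (he y _).2 ⟨c, rfl⟩
    obtain ⟨d, rfl⟩ := (he x _).1 h0
    refine ⟨d, hi y ?_⟩
    rw [app_map_apply, ha]

theorem Tame.cokernel {M N : PersMod k} (hM : Tame M) (hN : Tame N) (f : M ⟶ N) :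
    Tame (cokernel f) := by
  obtain ⟨T, hM, hN⟩ := hM.exists_common hN
  exact ⟨T, hM.cokernel hN f⟩

theorem Tame.kernel {M N : PersMod k} (hM : Tame M) (hN : Tame N) (f : M ⟶ N) :
    Tame (kernel f) := by
  obtain ⟨T, hM, hN⟩ := hM.exists_common hN
  exact ⟨T, hM.kernel hN f⟩

/-- The value of a finite direct sum at a point is the product of the values. -/
def biproductEquiv {ι : Type} [Fintype ι] (f : ι → PersMod k) (x : ℝ) :
    (⨁ f).obj x ≃ₗ[k] ∀ i, (f i).obj x where
  toFun v i := (biproduct.π f i).app x v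
  map_add' v w := by
    funext i
    exact map_add _ v w
  map_smul' c v := by
    funext i
    exact map_smul ((biproduct.π f i).app x).hom c v
  invFun w := ∑ i, (biproduct.ι f i).app x (w i)
  left_inv v := by
    have h : ((∑ i, biproduct.π f i ≫ biproduct.ι f i : (⨁ f) ⟶ (⨁ f)).app x).hom v = v := by
      rw [biproduct.total]
      rfl
    rw [NatTrans.app_sum, ModuleCat.hom_sum, LinearMap.sum_apply] at h
    exact h
  right_inv w := by
    classical
    funext j
    change (biproduct.π f j).app x (∑ i, (biproduct.ι f i).app x (w i)) = w j
    rw [map_sum, Finset.sum_eq_single j]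
    · rw [← ConcreteCategory.comp_apply, ← NatTrans.comp_app, biproduct.ι_π_self]
      rfl
    · intro i _ hij
      rw [← ConcreteCategory.comp_apply, ← NatTrans.comp_app, biproduct.ι_π_ne f hij]
      rfl
    · simp

theorem TameOn.biproduct {ι : Type} [Fintype ι] {T : Finset ℝ} {f : ι → PersMod k}
    (hf : ∀ i, TameOn T (f i)) : TameOn T (⨁ f) := by
  refine ⟨fun x => ?_, fun x hx => ?_, fun x y g hg => ?_⟩
  · have := fun i => (hf i).finite x
    exact Module.Finite.equiv (biproductEquiv f x).symm
  · have := fun i => (hf i).subsingleton x hx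
    exact (biproductEquiv f x).injective.subsingleton
  · have h : biproductEquiv f y ∘ (⨁ f).map g =
        Pi.map (fun i => (f i).map g) ∘ biproductEquiv f x := by
      funext v i
      exact app_map_apply (biproduct.π f i) g v
    refine ((biproductEquiv f y).bijective.of_comp_iff' _).1 ?_
    rw [h]
    exact (Function.Bijective.piMap fun i => (hf i).bijective x y g hg).comp
      (biproductEquiv f x).bijective

theorem Tame.biproduct {ι : Type} [Fintype ι] {f : ι → PersMod k} (hf : ∀ i, Tame (f i)) :
    Tame (⨁ f) := by
  classical
  choose T hT using hf
  exact ⟨Finset.univ.biUnion T, TameOn.biproduct fun i =>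
    (hT i).mono (Finset.subset_biUnion_of_mem T (Finset.mem_univ i))⟩

end Tame

/-! ### Maps into and out of interval modules -/

section IntervalMaps

variable {k : Type u} [Field k] {J : Set ℝ} {hJ : J.OrdConnected}

theorem subsingleton_intervalModule {x : ℝ} (hx : x ∉ J) :
    Subsingleton ((intervalModule k J hJ).obj x) :=
  ⟨fun c d => Subtype.ext ((c.2 hx).trans (d.2 hx).symm)⟩

theorem intervalModule_map_coe {x y : ℝ} (f : x ⟶ y) (hy : y ∈ J)
    (c : (intervalModule k J hJ).obj x) :
    ((intervalModule k J hJ).map f c : intervalSpace k J y).1 =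
      (show intervalSpace k J x from c).1 :=
  if_pos hy

/-- The value of an interval module at a point of the interval is the ground field. -/
def intervalSpaceEquiv {x : ℝ} (hx : x ∈ J) : intervalSpace k J x ≃ₗ[k] k where
  toFun c := c.1
  map_add' _ _ := rfl
  map_smul' _ _ := rfl
  invFun c := ⟨c, fun h => absurd hx h⟩
  left_inv _ := rfl
  right_inv _ := rfl

/-- Reduces tameness to membership: the structure maps are identities or maps between zero spaces as
long as `J` is neither entered nor left. -/
theorem tameOn_intervalModule {T : Finset ℝ} (h₀ : ∀ x, (∀ t ∈ T, x < t) → x ∉ J)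
    (h : ∀ x y : ℝ, x ≤ y → (∀ t ∈ T, t ≤ x ∨ y < t) → (x ∈ J ↔ y ∈ J)) :
    TameOn T (intervalModule k J hJ) := by
  refine ⟨fun x => ?_, fun x hx => subsingleton_intervalModule (h₀ x hx), fun x y f hf => ?_⟩
  · exact inferInstanceAs (FiniteDimensional k (intervalSpace k J x))
  · by_cases hx : x ∈ J
    · have hy := (h x y (leOfHom f) hf).1 hx
      refine ⟨fun c d hcd => ?_, fun c => ⟨(⟨c.1, fun h => absurd hx h⟩ : intervalSpace k J x),
        Subtype.ext (if_pos hy)⟩⟩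
      refine Subtype.ext ?_
      rw [← intervalModule_map_coe (hJ := hJ) f hy c, hcd, intervalModule_map_coe f hy d]
    · have := subsingleton_intervalModule (k := k) (hJ := hJ) hx
      have := subsingleton_intervalModule (k := k) (hJ := hJ)
        (fun hy => hx ((h x y (leOfHom f) hf).2 hy))
      exact ⟨Function.injective_of_subsingleton _, fun c => ⟨0, Subsingleton.elim _ _⟩⟩

theorem tame_freeModule (a : ℝ) : Tame (freeModule k a) := by
  refine ⟨{a}, tameOn_intervalModule (fun x hx h => ?_) fun x y hxy hf => ?_⟩
  · exact absurd (hx a (Finset.mem_singleton_self a)) (not_lt.2 h)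
  · have := hf a (Finset.mem_singleton_self a)
    simp only [Set.mem_Ici]
    grind

/-- The generator of an interval module whose interval has least element `a`. -/
def intervalOne (hJ : J.OrdConnected) {a : ℝ} (ha : a ∈ J) : (intervalModule k J hJ).obj a :=
  (⟨1, fun h => absurd ha h⟩ : intervalSpace k J a)

theorem eq_smul_map_intervalOne {a x : ℝ} (ha : a ∈ J) (f : a ⟶ x) (hx : x ∈ J)
    (c : (intervalModule k J hJ).obj x) :
    c = (show intervalSpace k J x from c).1 •
      (intervalModule k J hJ).map f (intervalOne hJ ha) := by
  refine Subtype.ext ?_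
  change _ = _ * ((intervalModule k J hJ).map f (intervalOne hJ ha) : intervalSpace k J x).1
  rw [intervalModule_map_coe f hx]
  exact (mul_one _).symm

/-- An interval module with a least point is cyclic, generated there by `intervalOne`. -/
theorem intervalModule_hom_ext {M : PersMod k} {a : ℝ} (ha : a ∈ J) (hmin : ∀ x ∈ J, a ≤ x)
    {φ ψ : intervalModule k J hJ ⟶ M}
    (h : φ.app a (intervalOne hJ ha) = ψ.app a (intervalOne hJ ha)) : φ = ψ := by
  ext x c
  by_cases hx : x ∈ J
  · rw [eq_smul_map_intervalOne ha (homOfLE (hmin x hx)) hx c, map_smul, map_smul]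
    congr 1
    exact (app_map_apply φ _ _).trans ((congrArg _ h).trans (app_map_apply ψ _ _).symm)
  · have := subsingleton_intervalModule (k := k) (hJ := hJ) hx
    rw [Subsingleton.elim c 0, map_zero, map_zero]

/-- The map from an interval module with least point `a` given by an element in degree `a` that
dies at the end of the interval. -/
def intervalDesc {M : PersMod k} {a : ℝ} (hmin : ∀ x ∈ J, a ≤ x) (v : M.obj a)
    (hv : ∀ (y : ℝ) (f : a ⟶ y), y ∉ J → M.map f v = 0) : intervalModule k J hJ ⟶ M where
  app x := ModuleCat.ofHom <|
    if h : a ≤ x then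
      (LinearMap.toSpanSingleton k (M.obj x) (M.map (homOfLE h) v)).comp
        (intervalSpace k J x).subtype
    else 0
  naturality x y f := by
    ext c
    by_cases hx : x ∈ J
    · change (dite (a ≤ y) _ _ : intervalSpace k J y →ₗ[k] M.obj y) (intervalMap k J x y c) =
        M.map f ((dite (a ≤ x) _ _ : intervalSpace k J x →ₗ[k] M.obj x) c)
      have hax := hmin x hx
      have hay := hax.trans (leOfHom f)
      rw [dif_pos hax, dif_pos hay]
      change (intervalMap k J x y c).1 • M.map (homOfLE hay) v =
        M.map f (c.1 • M.map (homOfLE hax) v)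
      rw [map_smul, map_map_apply M (homOfLE hax) f (homOfLE hay)]
      by_cases hy : y ∈ J
      · rw [show (intervalMap k J x y c).1 = c.1 from if_pos hy]
      · rw [hv y _ hy, smul_zero, smul_zero]
    · have := subsingleton_intervalModule (k := k) (hJ := hJ) hx
      rw [Subsingleton.elim c 0, map_zero, map_zero]

theorem intervalDesc_app_intervalOne {M : PersMod k} {a : ℝ} (ha : a ∈ J)
    (hmin : ∀ x ∈ J, a ≤ x) (v : M.obj a)
    (hv : ∀ (y : ℝ) (f : a ⟶ y), y ∉ J → M.map f v = 0) :
    (intervalDesc (hJ := hJ) hmin v hv).app a (intervalOne hJ ha) = v := by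
  change (dite (a ≤ a) _ _ : intervalSpace k J a →ₗ[k] M.obj a) _ = v
  rw [dif_pos le_rfl]
  change (1 : k) • M.map (homOfLE le_rfl) v = v
  rw [map_self_apply, one_smul]

/-- The map from a free module on a generator in degree `a` given by an element in degree `a`. -/
def freeDesc {M : PersMod k} {a : ℝ} (v : M.obj a) : freeModule k a ⟶ M :=
  intervalDesc (fun _ h => h) v fun _ f h => absurd (leOfHom f) h

theorem freeDesc_app_intervalOne {M : PersMod k} {a : ℝ} (v : M.obj a) :
    (freeDesc v).app a (intervalOne Set.ordConnected_Ici (Set.self_mem_Ici)) = v :=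
  intervalDesc_app_intervalOne _ _ _ _

instance projective_freeModule (a : ℝ) : Projective (freeModule k a) where
  factors {E X} f e _ := by
    obtain ⟨w, hw⟩ := app_surjective_of_epi e a
      (f.app a (intervalOne Set.ordConnected_Ici (Set.self_mem_Ici)))
    refine ⟨freeDesc w, intervalModule_hom_ext Set.self_mem_Ici (fun _ h => h) ?_⟩
    rw [NatTrans.comp_app, ConcreteCategory.comp_apply, freeDesc_app_intervalOne, hw]

end IntervalMaps

/-! ### Finitely presented is equivalent to tame -/

section FinitePresentation

variable {k : Type u} [Field k]

theorem tame_of_isFinitelyPresented {M : PersMod k} (hM : IsFinitelyPresented M) : Tame M := by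
  obtain ⟨m, n, a, b, f, ⟨e⟩⟩ := hM
  exact ((Tame.biproduct fun j => tame_freeModule (b j)).cokernel
    (Tame.biproduct fun i => tame_freeModule (a i)) f).of_iso e.symm

/-- In a tame module, the elements in degree `x` come from the largest critical value below `x`. -/
theorem TameOn.exists_critical {T : Finset ℝ} {M : PersMod k} (h : TameOn T M) (x : ℝ)
    [Nontrivial (M.obj x)] :
    ∃ t ∈ T, ∃ f : t ⟶ x, Function.Bijective (M.map f) := by
  have hne : (T.filter (· ≤ x)).Nonempty := by
    by_contra hT
    rw [Finset.not_nonempty_iff_eq_empty, Finset.filter_eq_empty_iff] at hT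
    have := h.subsingleton x fun t ht => not_le.1 (hT ht)
    exact not_subsingleton _ this
  obtain ⟨t, ht, hmax⟩ := Finset.exists_max_image _ id hne
  rw [Finset.mem_filter] at ht
  refine ⟨t, ht.1, homOfLE ht.2, h.bijective _ _ _ fun t' ht' => ?_⟩
  by_cases hx : t' ≤ x
  · exact Or.inl (hmax t' (Finset.mem_filter.2 ⟨ht', hx⟩))
  · exact Or.inr (not_le.1 hx)

theorem Tame.exists_free_cover {M : PersMod k} (hM : Tame M) :
    ∃ (n : ℕ) (a : Fin n → ℝ) (p : (⨁ fun i => freeModule k (a i)) ⟶ M), Epi p := by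
  obtain ⟨T, h⟩ := hM
  have := h.finite
  -- One generator for each basis vector of each `M(t)`, `t ∈ T`. They suffice because every element
  -- is pushed forward from a critical value.
  let I := Σ t : T, Fin (Module.finrank k (M.obj t))
  let e : Fin (Fintype.card I) ≃ I := (Fintype.equivFin I).symm
  let v : ∀ i : I, M.obj i.1 := fun i => Module.finBasis k (M.obj i.1) i.2
  let p : (⨁ fun i => freeModule k ((e i).1 : ℝ)) ⟶ M := biproduct.desc fun i => freeDesc (v (e i))
  refine ⟨_, fun i => (e i).1, p, ?_⟩
  have hr : ∀ (i : I) (x : ℝ) (f : (i.1 : ℝ) ⟶ x),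
      M.map f (v i) ∈ LinearMap.range (p.app x).hom := by
    intro i x f
    obtain ⟨j, rfl⟩ := e.surjective i
    have h1 : biproduct.ι (fun i => freeModule k ((e i).1 : ℝ)) j ≫ p = freeDesc (v (e j)) :=
      biproduct.ι_desc _ _
    refine ⟨(biproduct.ι (fun i => freeModule k ((e i).1 : ℝ)) j).app x
      ((freeModule k ((e j).1 : ℝ)).map f
        (intervalOne Set.ordConnected_Ici (Set.self_mem_Ici))), ?_⟩
    change (biproduct.ι (fun i => freeModule k ((e i).1 : ℝ)) j ≫ p).app x _ = _
    rw [h1, app_map_apply, freeDesc_app_intervalOne]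
  have hepi : ∀ x, Epi (p.app x) := by
    intro x
    rw [ModuleCat.epi_iff_surjective]
    rcases subsingleton_or_nontrivial (M.obj x) with hx | hx
    · exact fun w => ⟨0, Subsingleton.elim _ _⟩
    obtain ⟨t, ht, f, hf⟩ := h.exists_critical x
    intro w
    obtain ⟨w, rfl⟩ := hf.2 w
    change _ ∈ LinearMap.range (p.app x).hom
    rw [← (Module.finBasis k (M.obj t)).sum_repr w, map_sum]
    refine Submodule.sum_mem _ fun i _ => ?_
    rw [map_smul]
    exact Submodule.smul_mem _ _ (hr ⟨⟨t, ht⟩, i⟩ x f)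
  exact NatTrans.epi_of_epi_app p

/-- The kernel of a finite free cover is again tame, so it has a finite free cover of its own, which
supplies the relations. -/
theorem isFinitelyPresented_of_tame {M : PersMod k} (hM : Tame M) : IsFinitelyPresented M := by
  obtain ⟨m, a, p, hp⟩ := hM.exists_free_cover
  obtain ⟨n, b, q, hq⟩ :=
    ((Tame.biproduct fun i => tame_freeModule (a i)).kernel hM p).exists_free_cover
  refine ⟨m, n, a, b, q ≫ kernel.ι p, ⟨?_⟩⟩
  have hcoker : IsColimit (CokernelCofork.ofπ p (kernel.condition p)) :=
    Abelian.epiIsCokernelOfKernel _ (limit.isLimit _)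
  exact (hcoker.coconePointUniqueUpToIso (cokernelIsCokernel (kernel.ι p))) ≪≫
    (cokernelEpiComp q (kernel.ι p)).symm

end FinitePresentation

/-! ### Barcode decompositions and free resolutions -/

section Structure

/-- Splitting off the first summand of a finite direct sum. -/
def biproductFinSuccIso {C : Type*} [Category* C] [Preadditive C] [HasFiniteBiproducts C]
    [HasBinaryBiproducts C] {n : ℕ} (f : Fin (n + 1) → C) :
    ⨁ f ≅ f 0 ⊞ ⨁ fun i : Fin n => f i.succ where
  hom := biprod.lift (biproduct.π f 0) (biproduct.lift fun i : Fin n => biproduct.π f i.succ)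
  inv := biprod.desc (biproduct.ι f 0) (biproduct.desc fun i : Fin n => biproduct.ι f i.succ)
  hom_inv_id := by
    rw [biprod.lift_desc, biproduct.lift_desc,
      ← Fin.sum_univ_succ (fun i => biproduct.π f i ≫ biproduct.ι f i), biproduct.total]
  inv_hom_id := by
    ext i j
    · simp
    · simp [biproduct.ι_π_ne f (Fin.succ_ne_zero _).symm]
    · simp [biproduct.ι_π_ne f (Fin.succ_ne_zero _)]
    · simp [biproduct.ι_π, Fin.succ_inj, Category.assoc]

variable {k : Type u} [Field k]

theorem tameOn_bar {T : Finset ℝ} {β : Bar} (hb : β.birth ∈ T)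
    (hd : ∀ d : ℝ, β.death = d → d ∈ T) : TameOn T (β.module k) := by
  refine tameOn_intervalModule (fun x hx h => absurd (hx _ hb) (not_lt.2 h.1)) ?_
  intro x y hxy hf
  have h1 := hf _ hb
  have h2 : (x : WithTop ℝ) < β.death ↔ (y : WithTop ℝ) < β.death := by
    generalize β.death = d at hd
    induction d using WithTop.recTopCoe with
    | top => simp
    | coe d =>
      have := hf d (hd d rfl)
      rw [WithTop.coe_lt_coe, WithTop.coe_lt_coe]
      grind
  have h3 : β.birth ≤ x ↔ β.birth ≤ y := by grind
  exact and_congr h3 h2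

theorem tame_bar (β : Bar) : Tame (β.module k) := by
  classical
  refine ⟨insert β.birth (β.death.recTopCoe ∅ fun d => {d}), tameOn_bar (by simp) ?_⟩
  intro d hd
  simp [hd]

open Classical in
/-- A map to an interval module given by a compatible family of functionals on the interval. -/
def intervalLift {J : Set ℝ} {hJ : J.OrdConnected} {M : PersMod k}
    (hM : ∀ x y : ℝ, x ≤ y → x ∉ J → y ∈ J → Subsingleton (M.obj x))
    (ψ : ∀ x, x ∈ J → M.obj x →ₗ[k] k)
    (hψ : ∀ (x y : ℝ) (f : x ⟶ y) (hx : x ∈ J) (hy : y ∈ J) (m : M.obj x),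
      ψ y hy (M.map f m) = ψ x hx m) :
    M ⟶ intervalModule k J hJ where
  app x := ModuleCat.ofHom <|
    if h : x ∈ J then (intervalSpaceEquiv h).symm.toLinearMap ∘ₗ ψ x h else 0
  naturality x y f := by
    ext m
    by_cases hy : y ∈ J
    · by_cases hx : x ∈ J
      · refine Subtype.ext ?_
        refine Eq.trans ?_ (intervalModule_map_coe (hJ := hJ) f hy _).symm
        simp only [dif_pos hx, dif_pos hy]
        exact hψ x y f hx hy m
      · have := hM x y (leOfHom f) hx hy
        rw [Subsingleton.elim m 0, map_zero, map_zero]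
    · have := subsingleton_intervalModule (k := k) (hJ := hJ) hy
      exact Subsingleton.elim _ _

theorem intervalLift_app {J : Set ℝ} {hJ : J.OrdConnected} {M : PersMod k}
    (hM : ∀ x y : ℝ, x ≤ y → x ∉ J → y ∈ J → Subsingleton (M.obj x))
    (ψ : ∀ x, x ∈ J → M.obj x →ₗ[k] k)
    (hψ : ∀ (x y : ℝ) (f : x ⟶ y) (hx : x ∈ J) (hy : y ∈ J) (m : M.obj x),
      ψ y hy (M.map f m) = ψ x hx m) {x : ℝ} (hx : x ∈ J) (m : M.obj x) :
    ((intervalLift (hJ := hJ) hM ψ hψ).app x m : intervalSpace k J x).1 = ψ x hx m := by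
  classical
  change ((dite (x ∈ J) _ _ : M.obj x →ₗ[k] intervalSpace k J x) m).1 = _
  rw [dif_pos hx]
  rfl

/-- A nonzero tame module has a bar as a direct summand. -/
theorem TameOn.exists_bar_summand {T : Finset ℝ} {M : PersMod k} (h : TameOn T M)
    (hne : ∃ t ∈ T, Nontrivial (M.obj t)) :
    ∃ (β : Bar) (s : β.module k ⟶ M) (r : M ⟶ β.module k), s ≫ r = 𝟙 _ ∧ β.birth ∈ T ∧
      TameOn T (β.module k) := by
  classical
  -- Starting the bar at the first critical value where `M` is nonzero makes `M` vanish to its left,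
  -- so a retraction has no compatibility condition to meet there.
  obtain ⟨t₀, ht₀, hmin⟩ := Finset.exists_min_image (T.filter fun t => Nontrivial (M.obj t)) id
    (by simpa [Finset.Nonempty] using hne)
  rw [Finset.mem_filter] at ht₀
  have hzero : ∀ x < t₀, Subsingleton (M.obj x) := by
    intro x hx
    by_contra hx'
    rw [not_subsingleton_iff_nontrivial] at hx'
    obtain ⟨t, ht, f, hf⟩ := h.exists_critical x
    have := hmin t (Finset.mem_filter.2 ⟨ht, hf.2.nontrivial⟩)
    exact absurd (this.trans (leOfHom f)) (not_le.2 hx)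
  have := ht₀.2
  obtain ⟨v, hv⟩ := exists_ne (0 : M.obj t₀)
  -- `s₀` is the last critical value at which `v` survives; the bar dies at the next critical value
  -- `b`, with `b = ⊤` if there is none, since that is the minimum of the empty set.
  obtain ⟨s₀, hs₀, hmax⟩ := Finset.exists_max_image
    (T.filter fun t => ∃ f : t₀ ⟶ t, M.map f v ≠ 0) id
    ⟨t₀, Finset.mem_filter.2 ⟨ht₀.1, 𝟙 _, by rwa [map_self_apply]⟩⟩
  rw [Finset.mem_filter] at hs₀
  obtain ⟨hs₀T, f₀, hf₀⟩ := hs₀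
  have hts : t₀ ≤ s₀ := leOfHom f₀
  let b : WithTop ℝ := (T.filter (s₀ < ·)).min
  have hbmem : ∀ d : ℝ, b = d → d ∈ T ∧ s₀ < d := fun d hd =>
    Finset.mem_filter.1 (Finset.mem_of_min hd)
  have hble : ∀ t ∈ T, s₀ < t → b ≤ t := fun t ht hst =>
    Finset.min_le (Finset.mem_filter.2 ⟨ht, hst⟩)
  have hsb : (s₀ : WithTop ℝ) < b := by
    cases hb : b with
    | top => exact WithTop.coe_lt_top _
    | coe d => exact WithTop.coe_lt_coe.2 (hbmem d hb).2
  let β : Bar := ⟨t₀, b, lt_of_le_of_lt (WithTop.coe_le_coe.2 hts) hsb⟩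
  have hbij : ∀ (x : ℝ) (f : s₀ ⟶ x), (x : WithTop ℝ) < b → Function.Bijective (M.map f) := by
    intro x f hx
    refine h.bijective _ _ _ fun t ht => ?_
    by_cases hst : s₀ < t
    · exact Or.inr (WithTop.coe_lt_coe.1 (hx.trans_le (hble t ht hst)))
    · exact Or.inl (not_lt.1 hst)
  have hdie : ∀ (y : ℝ) (f : t₀ ⟶ y), y ∉ halfOpen t₀ b → M.map f v = 0 := by
    intro y f hy
    have hby : b ≤ y := not_lt.1 fun hlt => hy ⟨leOfHom f, hlt⟩
    obtain ⟨d, hd, hdy⟩ := WithTop.le_coe_iff.1 hby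
    obtain ⟨hdT, hsd⟩ := hbmem d hd
    have h0 : M.map (homOfLE (hts.trans hsd.le)) v = 0 := by
      by_contra hne
      exact absurd (hmax d (Finset.mem_filter.2 ⟨hdT, _, hne⟩)) (not_le.2 hsd)
    rw [← map_map_apply M (homOfLE (hts.trans hsd.le)) (homOfLE hdy) f, h0, map_zero]
  -- The retraction is determined by one functional on `M(s₀)` equal to `1` on the image of `v`. For
  -- `x` in the bar, push an element of `M(x)` to `max x s₀`, pull it back to `s₀` along the
  -- isomorphism `E`, and apply `φ`.
  obtain ⟨φ, hφ⟩ := Module.Projective.exists_dual_eq_one k hf₀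
  have hmaxlt : ∀ x ∈ halfOpen t₀ b, ((max x s₀ : ℝ) : WithTop ℝ) < b := by
    intro x hx
    rcases max_choice x s₀ with h | h <;> rw [h]
    exacts [hx.2, hsb]
  let E : ∀ x, x ∈ halfOpen t₀ b → M.obj s₀ ≃ₗ[k] M.obj (max x s₀) := fun x hx =>
    LinearEquiv.ofBijective (M.map (homOfLE (le_max_right x s₀))).hom (hbij _ _ (hmaxlt x hx))
  let ψ : ∀ x, x ∈ halfOpen t₀ b → M.obj x →ₗ[k] k := fun x hx =>
    φ ∘ₗ (E x hx).symm.toLinearMap ∘ₗ (M.map (homOfLE (le_max_left x s₀))).hom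
  -- The comparison with `M(s₀)` may be made at any point `y < b` above both `x` and `s₀`, as `M(s₀)
  -- → M(y)` is injective. This yields both compatibility of `ψ` and its value on `v`.
  have hψ_eq : ∀ (x : ℝ) (hx : x ∈ halfOpen t₀ b) (m : M.obj x) (u : M.obj s₀) (y : ℝ)
      (f : x ⟶ y) (g : s₀ ⟶ y), (y : WithTop ℝ) < b → M.map f m = M.map g u →
      ψ x hx m = φ u := by
    intro x hx m u y f g hy hmu
    change φ ((E x hx).symm (M.map (homOfLE (le_max_left x s₀)) m)) = φ u
    congr 1
    refine (hbij y g hy).1 ?_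
    rw [← hmu, ← map_map_apply M (homOfLE (le_max_right x s₀))
      (homOfLE (max_le (leOfHom f) (leOfHom g))) g]
    change M.map _ (E x hx ((E x hx).symm _)) = _
    rw [LinearEquiv.apply_symm_apply, map_map_apply M _ _ f]
  have hψ : ∀ (x y : ℝ) (f : x ⟶ y) (hx : x ∈ halfOpen t₀ b) (hy : y ∈ halfOpen t₀ b)
      (m : M.obj x), ψ y hy (M.map f m) = ψ x hx m := by
    intro x y f hx hy m
    refine (hψ_eq x hx m _ (max y s₀) (homOfLE ((leOfHom f).trans (le_max_left _ _)))
      (homOfLE (le_max_right _ _)) (hmaxlt y hy) ?_).symm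
    change _ = E y hy ((E y hy).symm _)
    rw [LinearEquiv.apply_symm_apply]
    exact (map_map_apply M _ _ _ m).symm
  have ha : t₀ ∈ halfOpen t₀ b := ⟨le_rfl, β.lt⟩
  let s : β.module k ⟶ M := intervalDesc (fun _ hx => hx.1) v hdie
  let r : M ⟶ β.module k := intervalLift (fun x y hxy hx hy => hzero x (not_le.1 fun htx =>
    hx ⟨htx, lt_of_le_of_lt (WithTop.coe_le_coe.2 hxy) hy.2⟩)) ψ hψ
  refine ⟨β, s, r, ?_, ht₀.1, tameOn_bar ht₀.1 fun d hd => (hbmem d hd).1⟩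
  refine intervalModule_hom_ext ha (fun _ hx => hx.1) ?_
  have hs : s.app t₀ (intervalOne _ ha) = v := intervalDesc_app_intervalOne ha _ v hdie
  refine (congrArg (r.app t₀) hs).trans ?_
  refine Subtype.ext ((intervalLift_app _ ψ hψ ha v).trans ?_)
  refine (hψ_eq t₀ ha v (M.map f₀ v) s₀ f₀ (𝟙 _) hsb ?_).trans hφ
  rw [map_self_apply]

theorem isZero_of_subsingleton {M : PersMod k} (h : ∀ x, Subsingleton (M.obj x)) : IsZero M :=
  Functor.isZero _ fun _ => ModuleCat.isZero_of_subsingleton _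

/-- Tame persistence modules have barcode decompositions. -/
theorem TameOn.exists_barcode {T : Finset ℝ} {M : PersMod k} (h : TameOn T M) :
    ∃ B, IsBarcode M B := by
  induction hn : ∑ t ∈ T, Module.finrank k (M.obj t) using Nat.strong_induction_on
    generalizing M with
  | _ n ih =>
  by_cases hne : ∃ t ∈ T, Nontrivial (M.obj t)
  · obtain ⟨β, s, r, hsr, hβT, hβ⟩ := h.exists_bar_summand hne
    have hK := h.kernel hβ r
    have hfin := h.finite
    have hi := app_injective_of_mono (kernel.ι r)
    have he : ∀ x, Function.Exact ((kernel.ι r).app x) (r.app x) :=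
      app_exact (ShortComplex.exact_kernel r)
    -- The total dimension over `T` drops strictly at the birth of the bar, where the split
    -- generator is not in the kernel of `r`.
    have hlt : ∑ t ∈ T, Module.finrank k ((Limits.kernel r).obj t) < n := by
      rw [← hn]
      refine Finset.sum_lt_sum (fun t _ =>
        LinearMap.finrank_le_finrank_of_injective (f := ((kernel.ι r).app t).hom) (hi t))
        ⟨β.birth, hβT, lt_of_le_of_ne (LinearMap.finrank_le_finrank_of_injective
          (f := ((kernel.ι r).app β.birth).hom) (hi _)) fun heq => ?_⟩
      have := hK.finite β.birth
      have hsurj := (LinearMap.injective_iff_surjective_of_finrank_eq_finrank heq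
        (f := ((kernel.ι r).app β.birth).hom)).1 (hi _)
      let o : (β.module k).obj β.birth := intervalOne _ ⟨le_rfl, β.lt⟩
      have h1 : r.app β.birth (s.app β.birth o) = o := by
        rw [← ConcreteCategory.comp_apply, ← NatTrans.comp_app, hsr]
        rfl
      rw [(he _ _).2 (hsurj _)] at h1
      exact zero_ne_one (congrArg Subtype.val h1)
    obtain ⟨B, ⟨e⟩⟩ := ih _ hlt hK rfl
    have hsplit := ShortComplex.Splitting.ofExactOfSection
      (ShortComplex.mk (kernel.ι r) r (kernel.condition r)) (ShortComplex.exact_kernel r) s hsr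
      inferInstance
    refine ⟨β :: B, ⟨hsplit.isoBinaryBiproduct ≪≫ biprod.braiding _ _ ≪≫
      biprod.mapIso (Iso.refl _) e ≪≫ ?_⟩⟩
    exact (biproductFinSuccIso fun i : Fin (B.length + 1) => ((β :: B).get i).module k).symm
  · have hsub : ∀ x, Subsingleton (M.obj x) := by
      intro x
      by_contra hx
      rw [not_subsingleton_iff_nontrivial] at hx
      obtain ⟨t, ht, f, hf⟩ := h.exists_critical x
      exact hne ⟨t, ht, hf.2.nontrivial⟩
    refine ⟨[], ⟨(isZero_of_subsingleton hsub).iso (isZero_of_subsingleton fun x => ?_)⟩⟩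
    have : IsEmpty (Fin ([] : List Bar).length) := Fin.isEmpty
    exact (biproductEquiv _ x).injective.subsingleton

/-- A tame module with injective structure maps is free of finite rank. -/
theorem Tame.exists_iso_free {M : PersMod k} (hM : Tame M)
    (hinj : ∀ (x y : ℝ) (f : x ⟶ y), Function.Injective (M.map f)) :
    ∃ (n : ℕ) (a : Fin n → ℝ), Nonempty (M ≅ ⨁ fun i => freeModule k (a i)) := by
  obtain ⟨T, hT⟩ := hM
  obtain ⟨B, ⟨e⟩⟩ := hT.exists_barcode
  refine ⟨B.length, fun i => (B.get i).birth, ⟨e ≪≫ biproduct.mapIso fun i => eqToIso ?_⟩⟩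
  -- A finite death would put a nonzero element into `M` that some structure map kills.
  have htop : (B.get i).death = ⊤ := by
    by_contra hne
    obtain ⟨d, hd⟩ := WithTop.ne_top_iff_exists.1 hne
    have hlt := (B.get i).lt
    let φ : (B.get i).module k ⟶ M := biproduct.ι (fun i => (B.get i).module k) i ≫ e.inv
    let o : ((B.get i).module k).obj (B.get i).birth := intervalOne _ ⟨le_rfl, hlt⟩
    rw [← hd, WithTop.coe_lt_coe] at hlt
    have : Subsingleton (((B.get i).module k).obj d) := subsingleton_intervalModule
      (fun h => absurd h.2 (by rw [← hd]; exact lt_irrefl _))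
    have h0 : ((B.get i).module k).map (homOfLE hlt.le) o = 0 := Subsingleton.elim _ _
    have h1 : φ.app _ o = 0 := by
      refine hinj _ _ (homOfLE hlt.le) ?_
      rw [← app_map_apply, h0, map_zero, map_zero]
    have h2 : o = 0 := app_injective_of_mono φ _ (h1.trans (map_zero _).symm)
    exact one_ne_zero (congrArg Subtype.val h2)
  have hset : halfOpen (B.get i).birth (B.get i).death = Set.Ici (B.get i).birth := by
    ext x
    rw [htop]
    simp [halfOpen]
  simp only [Bar.module, freeModule, hset]

/-- A tame module is the quotient of a finite free module by a finite free submodule. -/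
theorem Tame.exists_free_resolution {M : PersMod k} (hM : Tame M) :
    ∃ (m n : ℕ) (a : Fin m → ℝ) (b : Fin n → ℝ)
      (f : (⨁ fun j => freeModule k (b j)) ⟶ (⨁ fun i => freeModule k (a i)))
      (g : (⨁ fun i => freeModule k (a i)) ⟶ M) (h : f ≫ g = 0),
      (ShortComplex.mk f g h).ShortExact := by
  obtain ⟨m, a, p, hp⟩ := hM.exists_free_cover
  have hP := Tame.biproduct fun i => tame_freeModule (k := k) (a i)
  -- Injectivity of structure maps passes from the free cover to its submodule `kernel p`, which is
  -- therefore free.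
  have hinjP : ∀ (x y : ℝ) (f : x ⟶ y),
      Function.Injective ((⨁ fun i => freeModule k (a i)).map f) := by
    intro x y f v w hvw
    refine (biproductEquiv _ x).injective (funext fun i => Subtype.ext ?_)
    have h1 := congrArg ((biproduct.π (fun i => freeModule k (a i)) i).app y) hvw
    rw [app_map_apply, app_map_apply] at h1
    by_cases hx : a i ≤ x
    · have h2 := congrArg Subtype.val h1
      rwa [intervalModule_map_coe f (show y ∈ Set.Ici (a i) from hx.trans (leOfHom f)),
        intervalModule_map_coe f (show y ∈ Set.Ici (a i) from hx.trans (leOfHom f))] at h2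
    · have := subsingleton_intervalModule (k := k) (hJ := Set.ordConnected_Ici)
        (show x ∉ Set.Ici (a i) from hx)
      exact congrArg Subtype.val (this.elim _ _)
  obtain ⟨n, b, ⟨e⟩⟩ := (hP.kernel hM p).exists_iso_free fun x y f v w hvw =>
    app_injective_of_mono (kernel.ι p) x (hinjP x y f (by
      rw [← app_map_apply, ← app_map_apply, hvw]))
  have hz : (e.inv ≫ kernel.ι p) ≫ p = 0 := by
    rw [Category.assoc, kernel.condition, comp_zero]
  refine ⟨m, n, a, b, e.inv ≫ kernel.ι p, p, hz, ?_⟩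
  refine ShortComplex.shortExact_of_iso (S₁ := ShortComplex.mk (kernel.ι p) p (kernel.condition p))
    (ShortComplex.isoMk e (Iso.refl _) (Iso.refl _) (by simp) (by simp)) ?_
  exact { exact := ShortComplex.exact_kernel p }

end Structure

/-! ### Magnitude as a weighted integral of dimension -/

section DimensionIntegral

open MeasureTheory

variable {k : Type u} [Field k]

/-- The dimension of `M(x)`, weighted by `e^{-x}`. -/
def weightedDim (M : PersMod k) (x : ℝ) : ℝ := Module.finrank k (M.obj x) * Real.exp (-x)

theorem weightedDim_congr {M N : PersMod k} (e : M ≅ N) : weightedDim M = weightedDim N := by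
  funext x
  rw [weightedDim, weightedDim, (e.app x).toLinearEquiv.finrank_eq]

theorem weightedDim_biproduct {ι : Type} [Fintype ι] {f : ι → PersMod k}
    (hf : ∀ i, Tame (f i)) (x : ℝ) : weightedDim (⨁ f) x = ∑ i, weightedDim (f i) x := by
  have := fun i => (hf i).choose_spec.finite x
  simp only [weightedDim]
  rw [(biproductEquiv f x).finrank_eq, Module.finrank_pi_fintype, Nat.cast_sum, Finset.sum_mul]

theorem weightedDim_intervalModule {J : Set ℝ} (hJ : J.OrdConnected) :
    weightedDim (intervalModule k J hJ) = J.indicator fun x => Real.exp (-x) := by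
  funext x
  by_cases hx : x ∈ J
  · have h : Module.finrank k ((intervalModule k J hJ).obj x) = 1 :=
      (intervalSpaceEquiv hx).finrank_eq.trans (Module.finrank_self k)
    rw [weightedDim, h, Set.indicator_of_mem hx, Nat.cast_one, one_mul]
  · have := subsingleton_intervalModule (k := k) (hJ := hJ) hx
    rw [weightedDim, Module.finrank_zero_of_subsingleton, Set.indicator_of_notMem hx,
      Nat.cast_zero, zero_mul]

theorem measurableSet_halfOpen (a : ℝ) (b : WithTop ℝ) : MeasurableSet (halfOpen a b) :=
  (ordConnected_halfOpen a b).measurableSet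

theorem integrableOn_Ici_exp_neg (a : ℝ) :
    IntegrableOn (fun x => Real.exp (-x)) (Set.Ici a) := by
  rw [integrableOn_Ici_iff_integrableOn_Ioi]
  exact integrableOn_exp_neg_Ioi a

theorem integrableOn_halfOpen (a : ℝ) (b : WithTop ℝ) :
    IntegrableOn (fun x => Real.exp (-x)) (halfOpen a b) :=
  (integrableOn_Ici_exp_neg a).mono_set fun _ hx => hx.1

theorem integral_Ici_exp_neg (a : ℝ) : ∫ x in Set.Ici a, Real.exp (-x) = Real.exp (-a) := by
  rw [integral_Ici_eq_integral_Ioi, integral_exp_neg_Ioi]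

theorem integral_halfOpen (β : Bar) :
    ∫ x in halfOpen β.birth β.death, Real.exp (-x) = β.weight := by
  obtain ⟨a, b, hab⟩ := β
  cases b with
  | top =>
    have h : halfOpen a ⊤ = Set.Ici a := by
      ext x
      simp [halfOpen]
    change ∫ x in halfOpen a ⊤, _ = Real.exp (-a) - 0
    rw [h, integral_Ici_exp_neg, sub_zero]
  | coe d =>
    rw [WithTop.coe_lt_coe] at hab
    have h : halfOpen a d = Set.Ici a \ Set.Ici d := by
      ext x
      simp [halfOpen]
    change ∫ x in halfOpen a d, _ = Real.exp (-a) - Real.exp (-d)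
    rw [h, setIntegral_sdiff measurableSet_Ici (integrableOn_Ici_exp_neg a)
      (Set.Ici_subset_Ici.2 hab.le), integral_Ici_exp_neg, integral_Ici_exp_neg]

theorem integrable_weightedDim_bar (β : Bar) : Integrable (weightedDim (β.module k)) := by
  rw [Bar.module, weightedDim_intervalModule,
    integrable_indicator_iff (measurableSet_halfOpen _ _)]
  exact integrableOn_halfOpen _ _

theorem integral_weightedDim_bar (β : Bar) : ∫ x, weightedDim (β.module k) x = β.weight := by
  rw [Bar.module, weightedDim_intervalModule, integral_indicator (measurableSet_halfOpen _ _),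
    integral_halfOpen]

theorem IsBarcode.weightedDim_eq {M : PersMod k} {B : List Bar} (hB : IsBarcode M B) :
    weightedDim M = fun x => ∑ i : Fin B.length, weightedDim ((B.get i).module k) x := by
  obtain ⟨e⟩ := hB
  rw [weightedDim_congr e]
  funext x
  exact weightedDim_biproduct (fun i => tame_bar _) x

theorem Tame.integrable_weightedDim {M : PersMod k} (hM : Tame M) :
    Integrable (weightedDim M) := by
  obtain ⟨T, hT⟩ := hM
  obtain ⟨B, hB⟩ := hT.exists_barcode
  rw [hB.weightedDim_eq]
  exact integrable_finsetSum _ fun i _ => integrable_weightedDim_bar _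

theorem IsBarcode.integral_weightedDim {M : PersMod k} {B : List Bar} (hB : IsBarcode M B) :
    ∫ x, weightedDim M x = (B.map Bar.weight).sum := by
  rw [hB.weightedDim_eq, integral_finsetSum _ fun i _ => integrable_weightedDim_bar _]
  simp only [integral_weightedDim_bar]
  rw [← List.sum_ofFn, List.ofFn_comp' , List.ofFn_get]

/-- The magnitude of a tame module is the integral of its dimension against `e^{-x}`. In
particular it does not depend on the barcode decomposition. -/
theorem Tame.magnitude_eq {M : PersMod k} (hM : Tame M) :
    magnitude M = ∫ x, weightedDim M x := by
  have h : ∃ B, IsBarcode M B := hM.choose_spec.exists_barcode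
  rw [magnitude, dif_pos h, h.choose_spec.integral_weightedDim]

theorem Tame.magnitude_congr {M N : PersMod k} (hM : Tame M) (e : M ≅ N) :
    magnitude M = magnitude N := by
  rw [hM.magnitude_eq, (hM.of_iso e).magnitude_eq, weightedDim_congr e]

theorem tame_of_isZero {M : PersMod k} (hM : IsZero M) : Tame M := by
  have h : ∀ x, Subsingleton (M.obj x) := fun x =>
    ModuleCat.subsingleton_of_isZero (((evaluation ℝ (ModuleCat.{u} k)).obj x).map_isZero hM)
  exact ⟨∅, fun x => inferInstance, fun x _ => h x, fun x y f _ =>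
    ⟨Function.injective_of_subsingleton _, fun c => ⟨0, Subsingleton.elim _ _⟩⟩⟩

theorem magnitude_of_isZero {M : PersMod k} (hM : IsZero M) : magnitude M = 0 := by
  have h : ∀ x, Subsingleton (M.obj x) := fun x =>
    ModuleCat.subsingleton_of_isZero (((evaluation ℝ (ModuleCat.{u} k)).obj x).map_isZero hM)
  rw [(tame_of_isZero hM).magnitude_eq]
  simp [weightedDim, Module.finrank_zero_of_subsingleton]

theorem magnitude_biproduct {ι : Type} [Fintype ι] {f : ι → PersMod k} (hf : ∀ i, Tame (f i)) :
    magnitude (⨁ f) = ∑ i, magnitude (f i) := by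
  rw [(Tame.biproduct hf).magnitude_eq]
  simp only [weightedDim_biproduct hf]
  rw [integral_finsetSum _ fun i _ => (hf i).integrable_weightedDim]
  exact Finset.sum_congr rfl fun i _ => (hf i).magnitude_eq.symm

theorem magnitude_freeModule (a : ℝ) : magnitude (freeModule k a) = Real.exp (-a) := by
  rw [(tame_freeModule a).magnitude_eq, weightedDim_intervalModule,
    integral_indicator measurableSet_Ici, integral_Ici_exp_neg]

/-- Magnitude is additive: `|ker f| - |M| + |N| - |coker f| = 0`. -/
theorem magnitude_kernel_add {M N : PersMod k} (hM : Tame M) (hN : Tame N) (f : M ⟶ N) :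
    magnitude (kernel f) + magnitude N = magnitude M + magnitude (cokernel f) := by
  have hK := hM.kernel hN f
  have hC := hM.cokernel hN f
  rw [hK.magnitude_eq, hN.magnitude_eq, hM.magnitude_eq, hC.magnitude_eq,
    ← integral_add hK.integrable_weightedDim hN.integrable_weightedDim,
    ← integral_add hM.integrable_weightedDim hC.integrable_weightedDim]
  congr 1
  funext x
  simp only [weightedDim]
  rw [← add_mul, ← add_mul]
  congr 1
  have := hM.choose_spec.finite x
  have := hN.choose_spec.finite x
  -- The integrands agree at each point: rank-nullity for `f` and for `cokernel.π f`, with exactness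
  -- identifying the two kernels.
  have he₁ : Function.Exact ((kernel.ι f).app x).hom (f.app x).hom :=
    app_exact (ShortComplex.exact_kernel f) x
  have he₂ : Function.Exact (f.app x).hom ((cokernel.π f).app x).hom :=
    app_exact (ShortComplex.exact_cokernel f) x
  have h₁ := LinearMap.finrank_range_of_inj (f := ((kernel.ι f).app x).hom)
    (app_injective_of_mono _ x)
  have h₂ := LinearMap.finrank_range_add_finrank_ker (f.app x).hom
  have h₃ := LinearMap.finrank_range_add_finrank_ker ((cokernel.π f).app x).hom
  rw [LinearMap.range_eq_top.2 (app_surjective_of_epi (cokernel.π f) x), finrank_top,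
    he₂.linearMap_ker_eq] at h₃
  rw [he₁.linearMap_ker_eq, h₁] at h₂
  norm_cast
  omega

theorem magnitude_shortExact {S : ShortComplex (PersMod k)} (hS : S.ShortExact) (h₁ : Tame S.X₁)
    (h₂ : Tame S.X₂) : magnitude S.X₂ = magnitude S.X₁ + magnitude S.X₃ := by
  have := hS.mono_f
  have := hS.epi_g
  have h := magnitude_kernel_add h₁ h₂ S.f
  rw [magnitude_of_isZero (isZero_kernel_of_mono S.f), zero_add,
    (h₁.cokernel h₂ S.f).magnitude_congr
      ((cokernelIsCokernel S.f).coconePointUniqueUpToIso hS.exact.gIsCokernel)] at h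
  exact h

end DimensionIntegral

/-! ### Right exactness of the tensor product -/

section RightExact

variable {k : Type u} [Field k]

/-- The functor `N ↦ ((s₁, s₂) ↦ M(s₁) ⊗ N(s₂))`. -/
def externalFunctor (M : PersMod k) : PersMod k ⥤ ℝ × ℝ ⥤ ModuleCat.{u} k where
  obj N := external M N
  map g := externalMap M g
  map_id N := by
    ext1; ext1 p
    exact MonoidalCategory.whiskerLeft_id _ _
  map_comp f g := by
    ext1; ext1 p
    exact MonoidalCategory.whiskerLeft_comp _ _ _

instance preservesFiniteColimits_externalFunctor (M : PersMod k) :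
    PreservesFiniteColimits (externalFunctor M) where
  preservesFiniteColimits J _ _ := preservesColimitsOfShape_of_evaluation _ J fun p =>
    inferInstanceAs (PreservesColimitsOfShape J
      ((evaluation ℝ (ModuleCat.{u} k)).obj p.2 ⋙ tensorLeft (M.obj p.1)))

/-- At each `s` the functor is a composite of the external product, restriction to the pairs with
`s₁ + s₂ ≤ s`, and a colimit, and colimits commute with colimits. -/
instance preservesFiniteColimits_tensoring (M : PersMod k) :
    PreservesFiniteColimits (tensoring M) where
  preservesFiniteColimits J _ _ := preservesColimitsOfShape_of_evaluation _ J fun s =>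
    inferInstanceAs (PreservesColimitsOfShape J
      (externalFunctor M ⋙
        (Functor.whiskeringLeft _ _ _).obj (CostructuredArrow.proj addFunctor s) ⋙ colim))

end RightExact

/-! ### Tensoring with free modules is translation -/

section TensorFree

variable {k : Type u} [Field k] {M N : PersMod k}

/-- The class in `(M ⊗ N)(s)` of a pure tensor in `M(s₁) ⊗ N(s₂)`, where `s₁ + s₂ ≤ s`. -/
def pureTensor {s s₁ s₂ : ℝ} (h : s₁ + s₂ ≤ s) (m : M.obj s₁) (n : N.obj s₂) :
    (tensor M N).obj s :=
  tensorι M N (CostructuredArrow.mk (S := addFunctor) (Y := (s₁, s₂)) (homOfLE h))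
    (TensorProduct.tmul k m n)

theorem pureTensor_smul {s s₁ s₂ : ℝ} (h : s₁ + s₂ ≤ s) (c : k) (m : M.obj s₁) (n : N.obj s₂) :
    pureTensor h (c • m) n = pureTensor h m (c • n) := by
  rw [pureTensor, TensorProduct.smul_tmul]
  rfl

theorem map_pureTensor {s t s₁ s₂ : ℝ} (h : s₁ + s₂ ≤ s) (f : s ⟶ t) (m : M.obj s₁)
    (n : N.obj s₂) :
    (tensor M N).map f (pureTensor h m n) = pureTensor (h.trans (leOfHom f)) m n :=
  congrArg (fun φ => φ.hom (TensorProduct.tmul k m n)) (tensorι_map M N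
    (CostructuredArrow.mk (S := addFunctor) (Y := (s₁, s₂)) (homOfLE h)) f)

/-- This is the relation imposed by the colimit: a tensor and its pushforward along the index
category have the same class. -/
theorem pureTensor_map {s s₁ s₂ t₁ t₂ : ℝ} (h : t₁ + t₂ ≤ s) (f : s₁ ⟶ t₁) (g : s₂ ⟶ t₂)
    (m : M.obj s₁) (n : N.obj s₂) :
    pureTensor h (M.map f m) (N.map g n) =
      pureTensor ((add_le_add (leOfHom f) (leOfHom g)).trans h) m n := by
  let j : CostructuredArrow addFunctor s :=
    CostructuredArrow.mk (S := addFunctor) (Y := (s₁, s₂))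
      (homOfLE ((add_le_add (leOfHom f) (leOfHom g)).trans h))
  let j' : CostructuredArrow addFunctor s :=
    CostructuredArrow.mk (S := addFunctor) (Y := (t₁, t₂)) (homOfLE h)
  let φ : j ⟶ j' := CostructuredArrow.homMk (f, g) rfl
  exact congrArg (fun ψ => ψ.hom (TensorProduct.tmul k m n))
    (colimit.w (CostructuredArrow.proj addFunctor s ⋙ external M N) φ)

theorem tensor_hom_ext_pureTensor {s : ℝ} {X : ModuleCat.{u} k} {f g : (tensor M N).obj s ⟶ X}
    (h : ∀ (s₁ s₂ : ℝ) (hs : s₁ + s₂ ≤ s) (m : M.obj s₁) (n : N.obj s₂),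
      f (pureTensor hs m n) = g (pureTensor hs m n)) : f = g := by
  refine tensor_hom_ext fun j => ModuleCat.hom_ext (TensorProduct.ext' fun m n => ?_)
  exact h j.left.1 j.left.2 (leOfHom j.hom) m n

/-- Translation by `-a` on the real line. -/
def translation (a : ℝ) : ℝ ⥤ ℝ where
  obj s := s - a
  map f := homOfLE (sub_le_sub_right (leOfHom f) a)

variable (M) in
/-- The pairing `M(s₁) ⊗ k[a,∞)(s₂) ⟶ M(s - a)`. -/
def freePairing (a s s₁ s₂ : ℝ) (h : s₁ + s₂ ≤ s) :
    M.obj s₁ ⊗ (freeModule k a).obj s₂ ⟶ M.obj (s - a) :=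
  ModuleCat.ofHom (TensorProduct.lift (
    if h' : a ≤ s₂ then
      (LinearMap.lsmul k (M.obj (s - a)) ∘ₗ (intervalSpace k (Set.Ici a) s₂).subtype).flip ∘ₗ
        (M.map (homOfLE (by linarith))).hom
    else 0))

theorem freePairing_tmul {a s s₁ s₂ : ℝ} (h : s₁ + s₂ ≤ s) (h' : a ≤ s₂) (m : M.obj s₁)
    (c : intervalSpace k (Set.Ici a) s₂) :
    freePairing M a s s₁ s₂ h (TensorProduct.tmul k m c) =
      c.1 • M.map (homOfLE (by linarith) : s₁ ⟶ s - a) m := by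
  refine (TensorProduct.lift.tmul _ _).trans ?_
  rw [dif_pos h']
  rfl

theorem freePairing_map {a s s₁ s₂ t₁ t₂ : ℝ} (f : s₁ ⟶ t₁) (g : s₂ ⟶ t₂) (h : s₁ + s₂ ≤ s)
    (h' : t₁ + t₂ ≤ s) (m : M.obj s₁) (c : intervalSpace k (Set.Ici a) s₂) :
    freePairing M a s t₁ t₂ h' (TensorProduct.tmul k (M.map f m)
      (intervalMap k (Set.Ici a) s₂ t₂ c)) =
      freePairing M a s s₁ s₂ h (TensorProduct.tmul k m c) := by
  by_cases ha : a ≤ s₂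
  · have ha' : a ≤ t₂ := ha.trans (leOfHom g)
    refine (freePairing_tmul h' ha' _ _).trans ((freePairing_tmul h ha m c).trans ?_).symm
    rw [map_map_apply M f (homOfLE (by linarith)) (homOfLE (by linarith)),
      show (intervalMap k (Set.Ici a) s₂ t₂ c).1 = c.1 from if_pos ha']
  · obtain rfl : c = 0 := Subtype.ext (c.2 ha)
    rw [map_zero]
    exact ((congrArg (freePairing M a s t₁ t₂ h').hom (TensorProduct.tmul_zero _ _)).trans
      (map_zero _)).trans ((congrArg (freePairing M a s s₁ s₂ h).hom
        (TensorProduct.tmul_zero _ _)).trans (map_zero _)).symm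

variable (M) in
/-- The cocone of pairings `M(s₁) ⊗ k[a,∞)(s₂) ⟶ M(s - a)`. -/
def freePairingCocone (a s : ℝ) :
    Cocone (CostructuredArrow.proj addFunctor s ⋙ external M (freeModule k a)) where
  pt := M.obj (s - a)
  ι :=
    { app := fun j => freePairing M a s j.left.1 j.left.2 (leOfHom j.hom)
      naturality := fun j j' φ => by
        refine ModuleCat.hom_ext (TensorProduct.ext' fun m c => ?_)
        exact freePairing_map φ.left.1 φ.left.2 (leOfHom j.hom) (leOfHom j'.hom) m c }

variable (M) in
/-- The map `(M ⊗ k[a,∞))(s) ⟶ M(s - a)`. -/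
def tensorFreeHom (a s : ℝ) : (tensor M (freeModule k a)).obj s ⟶ M.obj (s - a) :=
  colimit.desc _ (freePairingCocone M a s)

theorem tensorFreeHom_pureTensor {a s s₁ s₂ : ℝ} (h : s₁ + s₂ ≤ s) (m : M.obj s₁)
    (c : (freeModule k a).obj s₂) :
    tensorFreeHom M a s (pureTensor h m c) =
      freePairing M a s s₁ s₂ h (TensorProduct.tmul k m c) :=
  congrArg (fun ψ => ψ.hom (TensorProduct.tmul k m c))
    (colimit.ι_desc (freePairingCocone M a s)
      (CostructuredArrow.mk (S := addFunctor) (Y := (s₁, s₂)) (homOfLE h)))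

variable (M) in
/-- The map `M(s - a) ⟶ (M ⊗ k[a,∞))(s)`. -/
def tensorFreeInv (a s : ℝ) : M.obj (s - a) ⟶ (tensor M (freeModule k a)).obj s :=
  ModuleCat.ofHom ((tensorι M (freeModule k a) (CostructuredArrow.mk (S := addFunctor)
    (Y := (s - a, a)) (homOfLE (sub_add_cancel s a).le))).hom ∘ₗ
    (TensorProduct.mk k (M.obj (s - a)) ((freeModule k a).obj a)).flip
      (intervalOne Set.ordConnected_Ici Set.self_mem_Ici))

theorem tensorFreeInv_apply (a s : ℝ) (m : M.obj (s - a)) :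
    tensorFreeInv M a s m = pureTensor (sub_add_cancel s a).le m
      (intervalOne Set.ordConnected_Ici Set.self_mem_Ici) :=
  rfl

theorem tensorFreeHom_tensorFreeInv (a s : ℝ) (m : M.obj (s - a)) :
    tensorFreeHom M a s (tensorFreeInv M a s m) = m := by
  rw [tensorFreeInv_apply, tensorFreeHom_pureTensor]
  refine (freePairing_tmul _ le_rfl _ _).trans ?_
  rw [map_self_apply]
  exact one_smul _ _

theorem tensorFreeInv_tensorFreeHom (a s : ℝ) :
    tensorFreeHom M a s ≫ tensorFreeInv M a s = 𝟙 _ := by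
  refine tensor_hom_ext_pureTensor fun s₁ s₂ hs m c => ?_
  rw [ConcreteCategory.comp_apply, tensorFreeHom_pureTensor, ConcreteCategory.id_apply]
  by_cases h : a ≤ s₂
  · refine (congrArg (tensorFreeInv M a s) (freePairing_tmul hs h m c)).trans ?_
    let o : (freeModule k a).obj a := intervalOne Set.ordConnected_Ici Set.self_mem_Ici
    obtain ⟨d, hd⟩ : ∃ d : k, d = (show intervalSpace k (Set.Ici a) s₂ from c).1 := ⟨_, rfl⟩
    have hc : c = (freeModule k a).map (homOfLE h) (d • o) := by
      rw [map_smul, hd]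
      exact eq_smul_map_intervalOne Set.self_mem_Ici (homOfLE h) h c
    rw [tensorFreeInv_apply, pureTensor_smul, ← hd, hc]
    -- Both classes come from the tensor of `m` and `d • o` at `(s₁, a)`: one by moving the second
    -- index up to `s₂`, the other by moving the first up to `s - a`.
    have h₁ := pureTensor_map hs (𝟙 s₁) (homOfLE h) m (d • o)
    have h₂ := pureTensor_map (sub_add_cancel s a).le (homOfLE (by linarith) : s₁ ⟶ s - a) (𝟙 a)
      m (d • o)
    rw [map_self_apply] at h₁ h₂
    exact h₂.trans h₁.symm
  · have := subsingleton_intervalModule (k := k) (hJ := Set.ordConnected_Ici)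
      (show s₂ ∉ Set.Ici a from h)
    obtain rfl : c = 0 := this.elim _ _
    rw [pureTensor, TensorProduct.tmul_zero]
    erw [map_zero, map_zero]

theorem tensorFreeInv_naturality (a : ℝ) {s t : ℝ} (f : s ⟶ t) (m : M.obj (s - a)) :
    tensorFreeInv M a t (M.map (homOfLE (sub_le_sub_right (leOfHom f) a)) m) =
      (tensor M (freeModule k a)).map f (tensorFreeInv M a s m) := by
  rw [tensorFreeInv_apply, tensorFreeInv_apply, map_pureTensor]
  have h := pureTensor_map (sub_add_cancel t a).le
    (homOfLE (sub_le_sub_right (leOfHom f) a)) (𝟙 a) m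
    (intervalOne (k := k) Set.ordConnected_Ici Set.self_mem_Ici)
  rw [map_self_apply] at h
  exact h

variable (M) in
/-- Tensoring with `k[a,∞)` translates by `a`. -/
def tensorFreeIso (a : ℝ) : translation a ⋙ M ≅ tensor M (freeModule k a) :=
  NatIso.ofComponents
    (fun s =>
      { hom := tensorFreeInv M a s
        inv := tensorFreeHom M a s
        hom_inv_id := by
          ext m
          exact tensorFreeHom_tensorFreeInv a s m
        inv_hom_id := tensorFreeInv_tensorFreeHom a s })
    fun f => by
      ext m
      exact tensorFreeInv_naturality a f m

theorem Tame.translation {M : PersMod k} (hM : Tame M) (a : ℝ) : Tame (translation a ⋙ M) := by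
  classical
  obtain ⟨T, hT⟩ := hM
  refine ⟨T.image (· + a), fun x => hT.finite _, fun x hx => hT.subsingleton _ fun t ht => ?_,
    fun x y f hf => hT.bijective _ _ _ fun t ht => ?_⟩
  · exact sub_lt_iff_lt_add.2 (hx _ (Finset.mem_image_of_mem _ ht))
  · exact (hf _ (Finset.mem_image_of_mem _ ht)).imp le_sub_iff_add_le.2 sub_lt_iff_lt_add.2

/-- Lebesgue measure is translation invariant, and `e^{-x} = e^{-(x-a)} e^{-a}`. -/
theorem magnitude_translation {M : PersMod k} (hM : Tame M) (a : ℝ) :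
    magnitude (translation a ⋙ M) = magnitude M * Real.exp (-a) := by
  rw [(hM.translation a).magnitude_eq, hM.magnitude_eq, ← MeasureTheory.integral_mul_const,
    ← MeasureTheory.integral_sub_right_eq_self (fun x => weightedDim M x * Real.exp (-a)) a]
  congr 1
  funext x
  change (Module.finrank k (M.obj (x - a)) : ℝ) * Real.exp (-x) =
    Module.finrank k (M.obj (x - a)) * Real.exp (-(x - a)) * Real.exp (-a)
  rw [mul_assoc, ← Real.exp_add]
  congr 2
  ring

/-- The tensor product with a finite free module is a finite direct sum of translates. -/
def tensorFiniteFreeIso (M : PersMod k) {n : ℕ} (a : Fin n → ℝ) :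
    (tensoring M).obj (⨁ fun i => freeModule k (a i)) ≅ ⨁ fun i => translation (a i) ⋙ M :=
  (tensoring M).mapBiproduct _ ≪≫ biproduct.mapIso fun i => (tensorFreeIso M (a i)).symm

theorem Tame.tensor_finiteFree {M : PersMod k} (hM : Tame M) {n : ℕ} (a : Fin n → ℝ) :
    Tame ((tensoring M).obj (⨁ fun i => freeModule k (a i))) :=
  (Tame.biproduct fun i => hM.translation (a i)).of_iso (tensorFiniteFreeIso M a).symm

theorem magnitude_tensor_finiteFree {M : PersMod k} (hM : Tame M) {n : ℕ} (a : Fin n → ℝ) :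
    magnitude ((tensoring M).obj (⨁ fun i => freeModule k (a i))) =
      magnitude M * magnitude (⨁ fun i => freeModule k (a i)) := by
  rw [(hM.tensor_finiteFree a).magnitude_congr (tensorFiniteFreeIso M a),
    magnitude_biproduct fun i => hM.translation (a i),
    magnitude_biproduct fun i => tame_freeModule (a i), Finset.mul_sum]
  simp only [magnitude_translation hM, magnitude_freeModule]

end TensorFree

/-! ### Tor from a finite free resolution -/

section TorFormula

variable {k : Type u} [Field k]

theorem projective_finiteFree {n : ℕ} (a : Fin n → ℝ) :
    Projective (⨁ fun i => freeModule k (a i)) where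
  factors f e _ := by
    refine ⟨biproduct.desc fun i =>
      Projective.factorThru (biproduct.ι (fun i => freeModule k (a i)) i ≫ f) e, ?_⟩
    refine biproduct.hom_ext' _ _ fun i => ?_
    rw [← Category.assoc, biproduct.ι_desc, Projective.factorThru_comp]

/-- Right exactness identifies `Tor₀` with the tensor product itself and makes the latter preserve
the cokernel `S.X₃`; projectivity of the other terms plays no role. -/
theorem tor_zero_iso_cokernel (M : PersMod k) {S : ShortComplex (PersMod k)}
    (hS : S.ShortExact) : Nonempty (tor 0 M S.X₃ ≅ cokernel ((tensoring M).map S.f)) := by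
  have := hS.epi_g
  let F := tensoring M
  exact ⟨F.leftDerivedZeroIsoSelf.app S.X₃ ≪≫
    (CokernelCofork.mapIsColimit _ hS.exact.gIsCokernel F).coconePointUniqueUpToIso
      (colimit.isColimit (parallelPair (F.map S.f) 0))⟩

/-- For tame modules, `Tor₀(M, N)` and `Tor₁(M, N)` are the cokernel and the kernel of a map
between tame modules whose magnitudes differ by `|M| |N|`, and the higher `Tor` vanish. -/
theorem exists_tor_presentation {M N : PersMod k} (hM : Tame M) (hN : Tame N) :
    ∃ (A B : PersMod k) (f : A ⟶ B), Tame A ∧ Tame B ∧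
      magnitude B - magnitude A = magnitude M * magnitude N ∧
      Nonempty (tor 0 M N ≅ cokernel f) ∧ Nonempty (tor 1 M N ≅ kernel f) ∧
      ∀ i, 2 ≤ i → IsZero (tor i M N) := by
  obtain ⟨m, n, a, b, f, g, hfg, hS⟩ := hN.exists_free_resolution
  have hmag : magnitude ((tensoring M).obj (⨁ fun i => freeModule k (a i))) -
      magnitude ((tensoring M).obj (⨁ fun j => freeModule k (b j))) =
      magnitude M * magnitude N := by
    have h : magnitude (⨁ fun i => freeModule k (a i)) =
        magnitude (⨁ fun j => freeModule k (b j)) + magnitude N :=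
      magnitude_shortExact hS (Tame.biproduct fun j => tame_freeModule (b j))
        (Tame.biproduct fun i => tame_freeModule (a i))
    rw [magnitude_tensor_finiteFree hM, magnitude_tensor_finiteFree hM, h]
    ring
  have hA := hM.tensor_finiteFree b
  have hB := hM.tensor_finiteFree a
  have h₁ := projective_finiteFree (k := k) b
  have h₂ := projective_finiteFree (k := k) a
  have ht₀ := tor_zero_iso_cokernel M hS
  have ht₁ := leftDerived_one_iso_kernel (tensoring M) hS h₁ h₂
  have ht₂ := isZero_leftDerived_of_shortExact (tensoring M) hS h₁ h₂
  refine ⟨_, _, (tensoring M).map f, hA, hB, hmag, ht₀, ht₁, fun i hi => ?_⟩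
  obtain ⟨i, rfl⟩ := Nat.exists_eq_add_of_le' hi
  exact ht₂ i

end TorFormula

end Persistence
end

/-! ### The product formula and the alternating sum -/

open Persistence in
theorem mainTheorem3 {k : Type u} [Field k] (M N : PersMod k)
    (hM : IsFinitelyPresented M) (hN : IsFinitelyPresented N) :
    (IsFinitelyPresented (tensor M N) ∧ ∀ i : ℕ, IsFinitelyPresented (tor i M N)) ∧
    magnitude M * magnitude N = magnitude (tensor M N) - magnitude (tor 1 M N) ∧
    (∀ i : ℕ, 2 ≤ i → CategoryTheory.Limits.IsZero (tor i M N)) ∧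
    HasSum (fun i : ℕ => (-1 : ℝ) ^ i * magnitude (tor i M N)) (magnitude M * magnitude N) := by
  obtain ⟨A, B, f, hA, hB, hmag, ⟨e₀⟩, ⟨e₁⟩, hzero⟩ :=
    exists_tor_presentation (tame_of_isFinitelyPresented hM) (tame_of_isFinitelyPresented hN)
  have h₀ : Tame (tor 0 M N) := (hA.cokernel hB f).of_iso e₀.symm
  have h₁ : Tame (tor 1 M N) := (hA.kernel hB f).of_iso e₁.symm
  let e : tor 0 M N ≅ tensor M N := (tensoring M).leftDerivedZeroIsoSelf.app N
  have key : magnitude M * magnitude N = magnitude (tor 0 M N) - magnitude (tor 1 M N) := by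
    rw [h₀.magnitude_congr e₀, h₁.magnitude_congr e₁, ← hmag]
    linarith [magnitude_kernel_add hA hB f]
  refine ⟨⟨isFinitelyPresented_of_tame (h₀.of_iso e), fun i => isFinitelyPresented_of_tame ?_⟩,
    ?_, hzero, ?_⟩
  · match i with
    | 0 => exact h₀
    | 1 => exact h₁
    | i + 2 => exact tame_of_isZero (hzero _ (by omega))
  · rw [key, h₀.magnitude_congr e]
  -- Only the terms of index `0` and `1` can be nonzero, so the series is a finite sum.
  · have hsum := hasSum_sum_of_ne_finset_zero (s := Finset.range 2)
      (L := SummationFilter.unconditional ℕ)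
      (f := fun i : ℕ => (-1 : ℝ) ^ i * magnitude (tor i M N)) fun i hi => by
        rw [magnitude_of_isZero (hzero i (not_lt.1 fun h => hi (Finset.mem_range.2 h))), mul_zero]
    convert hsum using 1
    rw [key, Finset.sum_range_succ, Finset.sum_range_one]
    ring
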